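/- For a finite field $\mathbb{F}_q$ with $q$ elements, let $\Gamma(3,q)$ be the generalized Paley graph: the simple graph with vertex set $\mathbb{F}_q$ in which $u$ and $v$ are adjacent if and only if $v-u\in\{x^3 : x\in\mathbb{F}_q^*\}$ (this is symmetric because $-1=(-1)^3$), and let $\bar\Gamma(3,q)$ be its complement. The spectrum of a finite graph is the multiset of eigenvalues of its adjacency matrix, and its energy is the sum of the absolute values of these eigenvalues, counted with multiplicity. Two graphs with the same number of vertices are isospectral if their spectra coincide, and equienergetic if their energies coincide. **Theorem 5.1.** Let $p$ be a prime with $p\equiv 1 \pmod 3$. Let $t\ge 1$ be an integer such that $p^t=x^2+27y^2$ for some $x,y\in\mathbb{Z}$ with $\gcd(x,p)=1$. Then for each $s\in\{0,1,\ldots,t-1\}$ there are infinitely many integers $\ell\ge 1$ such that $\Gamma(3,p^{3(t\ell+s)})$ and $\bar\Gamma(3,p^{3(t\ell+s)})$ are equienergetic and non-isospectral. -/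

import Mathlib

noncomputable section

namespace GPGraph

/-- The set `R_k = {x ^ k : x ∈ F, x ≠ 0}` of nonzero `k`-th powers of a field `F`. -/
def nonzeroPowers (F : Type*) [Field F] (k : ℕ) : Set F :=
  {y | ∃ x : F, x ≠ 0 ∧ x ^ k = y}

/-- The generalized Paley graph `Γ(k, q) = X(F_q, R_k)`, for `F` the field with `q` elements: the
Cayley graph of the additive group of `F` with connection set `R_k`. It is used only when
`R_k = -R_k` (e.g. for odd `k`), where `u` and `v` are adjacent exactly when `v - u ∈ R_k`:
see `gpGraph_adj_iff_of_odd`. -/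
def gpGraph (F : Type*) [Field F] (k : ℕ) : SimpleGraph F :=
  SimpleGraph.addCayley (nonzeroPowers F k)

theorem gpGraph_adj_iff_of_odd (F : Type*) [Field F] {k : ℕ} (hk : Odd k) (u v : F) :
    (gpGraph F k).Adj u v ↔ v - u ∈ nonzeroPowers F k := by
  unfold gpGraph
  rw [SimpleGraph.addCayley_adj']
  constructor
  · rintro ⟨-, g, ⟨x, hx, rfl⟩, h | h⟩
    · exact ⟨x, hx, by rw [← h]; ring⟩
    · exact ⟨-x, neg_ne_zero.mpr hx, by rw [hk.neg_pow, h]; ring⟩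
  · rintro ⟨x, hx, h⟩
    refine ⟨?_, x ^ k, ⟨x, hx, rfl⟩, Or.inl (by rw [h]; ring)⟩
    rintro rfl
    rw [sub_self] at h
    exact hx (eq_zero_of_pow_eq_zero h)

open Classical in
/-- The spectrum of a finite graph: the multiset of eigenvalues of its (real symmetric) adjacency
matrix, i.e. the roots of the characteristic polynomial counted with multiplicity. -/
def spec {V : Type*} [Finite V] (G : SimpleGraph V) : Multiset ℝ :=
  letI := Fintype.ofFinite V
  (G.adjMatrix ℝ).charpoly.roots

/-- The energy of a finite graph: the sum of the absolute values of its eigenvalues, counted with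
multiplicity. -/
def energy {V : Type*} [Finite V] (G : SimpleGraph V) : ℝ :=
  ((spec G).map fun x => |x|).sum

/-- Two finite graphs are isospectral if they have the same spectrum (with multiplicities). -/
def Isospectral {V W : Type*} [Finite V] [Finite W] (G : SimpleGraph V) (H : SimpleGraph W) :
    Prop :=
  spec G = spec H

/-- Two finite graphs with the same number of vertices are equienergetic if they have the same
energy. -/
def Equienergetic {V W : Type*} [Finite V] [Finite W] (G : SimpleGraph V) (H : SimpleGraph W) :
    Prop :=
  Nat.card V = Nat.card W ∧ energy G = energy H

end GPGraph

end

/-! Let q = p^(3r) = 3a+1 and N = p^r. The nontrivial eigenvalues of Γ(3,q) are cubic Gaussian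
periods (2 Re(conj(χ(c)) G) - 1)/3, with G a cubic Gauss sum and G³ = q J for the Jacobi sum J =
J(χ,χ) in ℤ[ω]. J has norm q, is primary and is not divisible by p, which forces J = (-1)^(3r+1)
ρ^(3r) with ρ one of two conjugate primary elements π, star π of norm p (`IsPrimaryOfNorm.eq_pow`).
Hence J is a cube τ³ and G = Nσ with σ³ = τ³. The three periods are (N T - 1)/3, where the integers
T are the traces of σ, ω̄σ, ω̄²σ; they have sum 0 and product Tr(τ³). The complement has -1 - λ for
each nontrivial λ, and 2a in place of a. Since |λ| - |-1-λ| is -1 for λ ≥ 0 and 1 for λ ≤ -1, the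
energies agree if exactly two of the T are negative and one is positive, that is if Tr(τ³) > 0. The
spectra differ because 2a exceeds every |λ|. Finally Tr(τ³) > 0 for infinitely many r = tℓ+s,
because no positive power of π is real and so the relevant powers cannot stay in a half plane
(`infinite_setOf_trace_pos`). -/

open Finset

namespace GPGraph

/-! ### Eisenstein integers of norm p^m -/

/-- The ring `ℤ[ω]` of Eisenstein integers, with `ω ^ 2 + ω + 1 = 0`. -/
abbrev Eis : Type := QuadraticAlgebra ℤ (-1) (-1)

namespace Eis

open QuadraticAlgebra

theorem norm_eq (z : Eis) : z.norm = z.re ^ 2 - z.re * z.im + z.im ^ 2 := by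
  rw [norm_def]; ring

theorem eq_zero_of_norm_eq_zero {z : Eis} (h : z.norm = 0) : z = 0 := by
  rw [norm_eq] at h
  have h1 : z.im = 0 := by nlinarith [sq_nonneg (2 * z.re - z.im), sq_nonneg z.im]
  have h2 : z.re = 0 := by simpa [h1] using h
  ext <;> simp [h1, h2]

instance : NoZeroDivisors Eis where
  eq_zero_or_eq_zero_of_mul_eq_zero {z w} h := by
    have : z.norm * w.norm = 0 := by rw [← map_mul, h, QuadraticAlgebra.norm_zero]
    exact (mul_eq_zero.mp this).imp eq_zero_of_norm_eq_zero eq_zero_of_norm_eq_zero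

instance : IsDomain Eis := NoZeroDivisors.to_isDomain _

/-- The ring homomorphism from the Eisenstein integers that sends `ω` to `u`. -/
def lift {S : Type*} [CommRing S] (u : S) (hu : u ^ 2 + u + 1 = 0) : Eis →+* S :=
  (QuadraticAlgebra.lift (R := ℤ) (a := -1) (b := -1)
    ⟨u, by simp only [neg_smul, one_smul]; linear_combination hu⟩).toRingHom

theorem lift_apply {S : Type*} [CommRing S] (u : S) (hu : u ^ 2 + u + 1 = 0) (z : Eis) :
    lift u hu z = z.re + z.im * u := by
  simp [lift, QuadraticAlgebra.lift]

theorem lift_omega {S : Type*} [CommRing S] (u : S) (hu : u ^ 2 + u + 1 = 0) :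
    lift u hu ω = u := by
  simp [lift_apply]

theorem mul_star_self (z : Eis) : z * star z = (z.norm : Eis) := by
  rw [← algebraMap_norm_eq_mul_star]; simp

theorem natCast_dvd_iff (n : ℕ) (z : Eis) :
    (n : Eis) ∣ z ↔ (n : ℤ) ∣ z.re ∧ (n : ℤ) ∣ z.im := by
  constructor
  · rintro ⟨w, rfl⟩
    simp
  · rintro ⟨⟨x, hx⟩, ⟨y, hy⟩⟩
    exact ⟨⟨x, y⟩, by ext <;> simp [hx, hy]⟩

/-- Since J * star π has norm p^(m+2), p dividing its imaginary part also divides its real part;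
cancelling p = π * star π leaves π as a factor of J. This peels off one prime without unique
factorization. -/
theorem exists_eq_mul_of_dvd_im {p m : ℕ} (hp : p.Prime) (hp3 : p ≠ 3) {π J : Eis}
    (hπ : π.norm = p) (hJ : J.norm = p ^ (m + 1)) (hπ3 : 3 ∣ π.im) (hJ3 : 3 ∣ J.im)
    (hd : (p : ℤ) ∣ (J * star π).im) :
    ∃ J' : Eis, J = J' * π ∧ J'.norm = p ^ m ∧ 3 ∣ J'.im := by
  have hpz : (p : ℤ) ≠ 0 := by exact_mod_cast hp.ne_zero
  have hpp : Prime (p : ℤ) := Nat.prime_iff_prime_int.mp hp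
  have hn : (J * star π).norm = p ^ (m + 1) * p := by rw [map_mul, QuadraticAlgebra.norm_star, hJ, hπ]
  have hre : (p : ℤ) ∣ (J * star π).re := by
    rw [norm_eq] at hn
    refine hpp.dvd_of_dvd_pow (n := 2) ?_
    have : (J * star π).re ^ 2 = p * p ^ (m + 1)
        + (J * star π).im * ((J * star π).re - (J * star π).im) := by
      linear_combination hn
    rw [this]
    exact dvd_add (dvd_mul_right _ _) (hd.mul_right _)
  obtain ⟨J', hJ'⟩ := (natCast_dvd_iff p _).mpr ⟨hre, hd⟩
  have hp0 : (p : Eis) ≠ 0 := by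
    intro h
    have := congrArg QuadraticAlgebra.re h
    simp at this
    exact hp.ne_zero this
  refine ⟨J', ?_, ?_, ?_⟩
  · apply mul_left_cancel₀ hp0
    have h1 : π * star π = (p : Eis) := by rw [mul_star_self, hπ]; simp
    linear_combination (-J) * h1 + π * hJ'
  · rw [hJ', map_mul, QuadraticAlgebra.norm_natCast] at hn
    apply mul_left_cancel₀ (pow_ne_zero 2 hpz)
    rw [hn]; ring
  · have h3 : (3 : ℤ) ∣ p * J'.im := by
      have : (J * star π).im = p * J'.im := by rw [hJ']; simp
      rw [← this]
      obtain ⟨x, hx⟩ := hπ3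
      obtain ⟨y, hy⟩ := hJ3
      simp only [im_mul, im_star, re_star, hx, hy]
      exact ⟨y * π.re - J.re * x, by ring⟩
    refine (Int.prime_three.dvd_mul.mp h3).resolve_left fun h => hp3 ?_
    have : 3 ∣ p := by exact_mod_cast h
    exact ((Nat.prime_dvd_prime_iff_eq Nat.prime_three hp).mp this).symm

theorem eq_pow_of_norm_eq_pow {p : ℕ} (hp : p.Prime) (hp3 : p ≠ 3) {π : Eis}
    (hπ : π.norm = p) (hπ3 : 3 ∣ π.im) (m : ℕ) :
    ∀ J : Eis, J.norm = p ^ m → 3 ∣ J.im → ¬ (p : Eis) ∣ J →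
      ∃ ρ ∈ ({π, star π} : Set Eis), J = ρ ^ m ∨ J = -ρ ^ m := by
  have hpp : Prime (p : ℤ) := Nat.prime_iff_prime_int.mp hp
  -- Mixing the two conjugate primes would produce the factor π * star π = p, which is excluded.
  have key : ∀ k : ℕ, ∀ ρ ∈ ({π, star π} : Set Eis), ∀ σ ∈ ({π, star π} : Set Eis), ∀ J J' : Eis,
      J = J' * ρ → (J' = σ ^ k ∨ J' = -σ ^ k) → ¬ (p : Eis) ∣ J →
      J = ρ ^ (k + 1) ∨ J = -ρ ^ (k + 1) := by
    have h1 : π * star π = (p : Eis) := by rw [mul_star_self, hπ]; simp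
    intro k ρ hρ σ hσ J J' hJ hJ' hd
    by_cases hs : σ = ρ
    · subst hs
      rcases hJ' with h | h
      · left; rw [hJ, h, pow_succ]
      · right; rw [hJ, h, pow_succ]; ring
    · rcases k with _ | k
      · rcases hJ' with h | h <;> simp [hJ, h]
      · have h2 : σ * ρ = p := by
          rcases hρ with rfl | rfl <;> rcases hσ with rfl | rfl
          · exact absurd rfl hs
          · rw [mul_comm, h1]
          · exact h1
          · exact absurd rfl hs
        refine absurd ?_ hd
        rcases hJ' with h | h
        · exact ⟨σ ^ k, by rw [hJ, h, ← h2]; ring⟩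
        · exact ⟨-σ ^ k, by rw [hJ, h, ← h2]; ring⟩
  induction m with
  | zero =>
    intro J hJ hJ3 _
    refine ⟨π, by simp, ?_⟩
    rw [norm_eq] at hJ
    obtain ⟨y, hy⟩ := hJ3
    rw [hy] at hJ
    -- Of the six units, only ±1 have imaginary part divisible by 3.
    have h0 : y = 0 := by
      have : 27 * y ^ 2 ≤ 4 := by nlinarith [sq_nonneg (2 * J.re - 3 * y)]
      have : y ^ 2 ≤ 0 := by omega
      nlinarith
    subst h0
    have h1 : J.re = 1 ∨ J.re = -1 := by
      have : J.re ^ 2 = 1 := by linarith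
      rcases mul_eq_zero.mp (show (J.re - 1) * (J.re + 1) = 0 by linarith) with h | h
      · left; linarith
      · right; linarith
    rcases h1 with h | h
    · left; ext <;> simp [h, hy]
    · right; ext <;> simp [h, hy]
  | succ m ih =>
    intro J hJ hJ3 hd
    have hprod : (p : ℤ) ∣ (J * star π).im * (J * star (star π)).im := by
      have : (J * star π).im * (J * star (star π)).im
          = J.im ^ 2 * π.norm - π.im ^ 2 * J.norm := by
        rw [star_star, norm_eq, norm_eq]
        simp only [im_mul, im_star, re_star]
        ring
      rw [this, hπ, hJ]
      exact dvd_sub (dvd_mul_left _ _) (Dvd.dvd.mul_left (dvd_pow_self _ (by simp)) _)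
    have step : ∀ ρ ∈ ({π, star π} : Set Eis), (p : ℤ) ∣ (J * star ρ).im →
        ∃ ρ ∈ ({π, star π} : Set Eis), J = ρ ^ (m + 1) ∨ J = -ρ ^ (m + 1) := by
      intro ρ hρ hdvd
      have hρn : ρ.norm = p := by rcases hρ with rfl | rfl <;> simp [hπ]
      have hρ3 : 3 ∣ ρ.im := by rcases hρ with rfl | rfl <;> simpa using hπ3
      obtain ⟨J', h1, h2, h3⟩ := exists_eq_mul_of_dvd_im hp hp3 hρn hJ hρ3 hJ3 hdvd
      obtain ⟨σ, hσ, h4⟩ := ih J' h2 h3 (fun h => hd (h1 ▸ h.mul_right _))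
      exact ⟨ρ, hρ, key m ρ hρ σ hσ J J' h1 h4 hd⟩
    rcases hpp.dvd_or_dvd hprod with h | h
    · exact step π (by simp) h
    · exact step (star π) (by simp) h

/-- Reduction of the Eisenstein integers modulo the prime `1 - ω` above `3`. -/
def toZModThree : Eis →+* ZMod 3 := lift 1 (by decide)

theorem toZModThree_star (z : Eis) : toZModThree (star z) = toZModThree z := by
  simp only [toZModThree, lift_apply, re_star, im_star]
  have : (3 : ZMod 3) = 0 := by decide
  push_cast
  linear_combination (-(z.im : ZMod 3)) * this

/-- Primary elements (those that are `-1` modulo `3`) of norm `p ^ m` that are not divisible by `p`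
are determined up to conjugation. -/
theorem eq_neg_one_pow_mul_pow {p : ℕ} (hp : p.Prime) (hp3 : p ≠ 3) {π J : Eis}
    (hπ : π.norm = p) (hπ3 : 3 ∣ π.im) (hπ1 : toZModThree π = -1) {m : ℕ} (hJ : J.norm = p ^ m)
    (hJ3 : 3 ∣ J.im) (hJ1 : toZModThree J = -1) (hd : ¬ (p : Eis) ∣ J) :
    ∃ ρ ∈ ({π, star π} : Set Eis), J = (-1) ^ (m + 1) * ρ ^ m := by
  obtain ⟨ρ, hρ, h⟩ := eq_pow_of_norm_eq_pow hp hp3 hπ hπ3 m J hJ hJ3 hd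
  refine ⟨ρ, hρ, ?_⟩
  -- Modulo 1 - ω, ρ^m becomes (-1)^m, so the congruence J ≡ -1 fixes the sign.
  have hρ1 : toZModThree ρ = -1 := by
    rcases hρ with rfl | rfl
    · exact hπ1
    · rw [toZModThree_star, hπ1]
  have hne : (1 : ZMod 3) ≠ -1 := by decide
  have hne' : (-1 : ZMod 3) ≠ 1 := by decide
  rcases h with h | h <;> rcases Nat.even_or_odd m with hm | hm
  · rw [h, map_pow, hρ1, hm.neg_one_pow] at hJ1
    exact absurd hJ1 hne
  · rw [h, hm.add_one.neg_one_pow, one_mul]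
  · rw [h, hm.add_one.neg_one_pow]; ring
  · rw [h, map_neg, map_pow, hρ1, hm.neg_one_pow, neg_neg] at hJ1
    exact absurd hJ1 hne

end Eis

/-! ### Cubic characters with Eisenstein values -/

namespace Eis

open QuadraticAlgebra

theorem omega_relation : (ω : Eis) ^ 2 + ω + 1 = 0 := by
  ext <;> simp [pow_two]

theorem omega_pow_three : (ω : Eis) ^ 3 = 1 := by
  linear_combination (ω - 1 : Eis) * omega_relation

theorem isPrimitiveRoot_omega : IsPrimitiveRoot (ω : Eis) 3 := by
  refine IsPrimitiveRoot.of_map_of_injective (f := MonoidHom.id Eis) ?_ (fun _ _ h => h)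
  refine (IsPrimitiveRoot.iff_orderOf).mpr (orderOf_eq_prime omega_pow_three ?_)
  intro h
  have := congrArg QuadraticAlgebra.im h
  simp at this

end Eis

open Eis QuadraticAlgebra in
/-- A finite field with `q ≡ 1 [MOD 3]` elements has a cubic character with values in the
Eisenstein integers; it reduces to a power map under a ring homomorphism to the field. -/
theorem exists_cubicChar (F : Type*) [Field F] [Fintype F] {a : ℕ} (ha : Fintype.card F = 3 * a + 1) :
    ∃ (χ : MulChar F Eis) (φ : Eis →+* F), χ ^ 3 = 1 ∧ (∃ x, χ x = ω) ∧
      (∀ x, x ≠ 0 → (χ x = 1 ↔ x ∈ nonzeroPowers F 3)) ∧ ∀ x, φ (χ x) = x ^ (2 * a) := by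
  classical
  obtain ⟨g, hg⟩ := IsCyclic.exists_generator (α := Fˣ)
  have hcard : Fintype.card Fˣ = 3 * a := by rw [Fintype.card_units, ha]; rfl
  have ha0 : 0 < a := by have := Fintype.card_pos (α := Fˣ); omega
  have hord : orderOf g = 3 * a := by
    rw [orderOf_eq_card_of_forall_mem_zpowers hg, Nat.card_eq_fintype_card, hcard]
  let w : Eisˣ := ⟨ω, ω ^ 2, by rw [← pow_succ', omega_pow_three],
    by rw [← pow_succ, omega_pow_three]⟩
  have hw : w ∈ rootsOfUnity (Fintype.card Fˣ) Eis := by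
    rw [mem_rootsOfUnity, hcard, pow_mul]
    have : w ^ 3 = 1 := by ext1; simpa using omega_pow_three
    rw [this, one_pow]
  let χ : MulChar F Eis := MulChar.ofRootOfUnity hw hg
  have hχg : χ g = ω := MulChar.ofRootOfUnity_spec hw hg
  -- Here φ sends ω to g^(2a) rather than g^a: with exponent a, the reduced Jacobi sum has degree 2a
  -- < q - 1 and vanishes, so it would give no information.
  have hu1 : (g : F) ^ (2 * a) ≠ 1 := by
    intro h
    have h' : g ^ (2 * a) = 1 := by ext1; simpa using h
    have := orderOf_dvd_of_pow_eq_one h'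
    rw [hord] at this
    have := Nat.le_of_dvd (by omega) this
    omega
  have hu : ((g : F) ^ (2 * a)) ^ 2 + (g : F) ^ (2 * a) + 1 = 0 := by
    have h3 : ((g : F) ^ (2 * a)) ^ 3 = 1 := by
      have : g ^ (3 * a) = 1 := by rw [← hord]; exact pow_orderOf_eq_one g
      have h' : (g : F) ^ (3 * a) = 1 := by
        rw [← Units.val_pow_eq_pow_val, this, Units.val_one]
      rw [← pow_mul, show 2 * a * 3 = 3 * a * 2 by ring, pow_mul, h', one_pow]
    apply mul_left_cancel₀ (sub_ne_zero.mpr hu1)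
    linear_combination h3
  have hpow : ∀ x : F, x ≠ 0 → ∃ k : ℕ, x = (g : F) ^ k := by
    intro x hx
    obtain ⟨k, hk⟩ := (mem_powers_iff_mem_zpowers).mpr (hg (Units.mk0 x hx))
    exact ⟨k, by simpa using (congrArg Units.val hk).symm⟩
  have hχk : ∀ k : ℕ, χ ((g : F) ^ k) = ω ^ k := fun k => by rw [map_pow, hχg]
  have hχ3 : ∀ x : F, x ≠ 0 → χ x ^ 3 = 1 := by
    intro x hx
    obtain ⟨k, rfl⟩ := hpow x hx
    rw [hχk, ← pow_mul, mul_comm, pow_mul, omega_pow_three, one_pow]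
  refine ⟨χ, Eis.lift _ hu, ?_, ⟨g, hχg⟩, ?_, ?_⟩
  · refine MulChar.ext fun x => ?_
    rw [MulChar.pow_apply_coe, MulChar.one_apply_coe, hχ3 _ x.ne_zero]
  · intro x hx
    constructor
    · intro h
      obtain ⟨k, rfl⟩ := hpow x hx
      rw [hχk] at h
      obtain ⟨j, rfl⟩ := isPrimitiveRoot_omega.dvd_of_pow_eq_one k h
      exact ⟨(g : F) ^ j, pow_ne_zero _ g.ne_zero, by rw [← pow_mul, mul_comm]⟩
    · rintro ⟨y, hy, rfl⟩
      rw [map_pow, hχ3 y hy]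
  · intro x
    by_cases hx : x = 0
    · subst hx
      rw [MulChar.map_zero, map_zero, zero_pow (by omega)]
    · obtain ⟨k, rfl⟩ := hpow x hx
      rw [hχk, map_pow, lift_omega, ← pow_mul, ← pow_mul, mul_comm]

/-! ### Jacobi sums are prime to p -/

/-- All base-p digits of a equal b, and 2b < p, so doubling a involves no carry; Lucas' theorem then
reduces to `(2 * b).choose b`. -/
theorem not_dvd_choose_two_mul {p : ℕ} (hp : p.Prime) {b : ℕ} (hb : p = 3 * b + 1) (m : ℕ) :
    ∀ a, p ^ m = 3 * a + 1 → ¬ p ∣ (2 * a).choose a := by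
  have : Fact p.Prime := ⟨hp⟩
  induction m with
  | zero =>
    intro a ha
    obtain rfl : a = 0 := by simpa using ha
    simpa using hp.one_lt.ne'
  | succ m ih =>
    intro a ha hdvd
    obtain ⟨a', ha'⟩ : ∃ a', p ^ m = 3 * a' + 1 := by
      have h1 : p ^ m % 3 = 1 := by
        rw [Nat.pow_mod, show p % 3 = 1 by omega]; simp
      exact ⟨p ^ m / 3, by omega⟩
    have hrec : a = p * a' + b := by
      have : 3 * a + 1 = (3 * a' + 1) * p := by rw [← ha, ← ha', pow_succ]
      nlinarith
    have h1 : a % p = b := by rw [hrec, Nat.mul_add_mod, Nat.mod_eq_of_lt (by omega)]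
    have h2 : a / p = a' := by
      rw [hrec, Nat.mul_add_div hp.pos, Nat.div_eq_of_lt (by omega), add_zero]
    have hrec2 : 2 * a = p * (2 * a') + 2 * b := by rw [hrec]; ring
    have h3 : 2 * a % p = 2 * b := by
      rw [hrec2, Nat.mul_add_mod, Nat.mod_eq_of_lt (by have := hp.two_le; omega)]
    have h4 : 2 * a / p = 2 * a' := by
      rw [hrec2, Nat.mul_add_div hp.pos, Nat.div_eq_of_lt (by have := hp.two_le; omega), add_zero]
    have h := Choose.choose_modEq_choose_mod_mul_choose_div_nat (n := 2 * a) (k := a) (p := p)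
    rw [h1, h2, h3, h4] at h
    rcases hp.dvd_mul.mp ((h.dvd_iff dvd_rfl).mp hdvd) with h5 | h5
    · have h6 : p ∣ (2 * b).factorial := by
        rw [← Nat.choose_mul_factorial_mul_factorial (show b ≤ 2 * b by omega)]
        exact (h5.mul_right _).mul_right _
      have := hp.dvd_factorial.mp h6
      have := hp.two_le
      omega
    · exact ih a' ha' h5

theorem sum_pow_eq_ite (F : Type*) [Field F] [Fintype F] {i : ℕ} (hi : i ≠ 0) :
    ∑ x : F, x ^ i = if Fintype.card F - 1 ∣ i then -1 else 0 := by
  classical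
  rw [← FiniteField.sum_pow_units, ← Finset.sum_sdiff (Finset.subset_univ {(0 : F)})]
  simp only [sum_singleton, zero_pow hi, add_zero]
  refine (Finset.sum_bij (fun (x : Fˣ) _ => (x : F)) ?_ ?_ ?_ ?_).symm
  · simp
  · intro x _ y _ h; exact Units.ext h
  · intro y hy
    simp only [mem_sdiff, mem_univ, mem_singleton, true_and] at hy
    exact ⟨Units.mk0 y hy, mem_univ _, rfl⟩
  · simp

/-- After expansion the exponents run from 2a to 4a, and 3a is the only multiple of q - 1 = 3a among
them. -/
theorem sum_pow_mul_one_sub_pow (F : Type*) [Field F] [Fintype F] {a : ℕ} (ha0 : 0 < a)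
    (ha : Fintype.card F = 3 * a + 1) :
    ∑ x : F, x ^ (2 * a) * (1 - x) ^ (2 * a) = -(-1) ^ a * ((2 * a).choose a : F) := by
  have h1 : ∀ x : F, x ^ (2 * a) * (1 - x) ^ (2 * a)
      = ∑ m ∈ range (2 * a + 1), (-1) ^ m * ((2 * a).choose m : F) * x ^ (2 * a + m) := by
    intro x
    rw [show (1 - x) = -x + 1 by ring, add_pow, mul_sum]
    refine sum_congr rfl fun m _ => ?_
    rw [neg_pow x, pow_add, one_pow]
    ring
  simp_rw [h1]
  rw [sum_comm, sum_eq_single a]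
  · rw [← mul_sum, sum_pow_eq_ite F (by omega), ha, if_pos ⟨1, by omega⟩]
    ring
  · intro m hm hma
    rw [← mul_sum, sum_pow_eq_ite F (by omega), ha, if_neg, mul_zero]
    rintro ⟨k, hk⟩
    have hm' := mem_range.mp hm
    rw [Nat.add_sub_cancel] at hk
    rcases k with _ | _ | k
    · omega
    · omega
    · have : 3 * a * (k + 1 + 1) = 3 * a * k + 6 * a := by ring
      omega
  · intro h
    exact absurd (mem_range.mpr (by omega)) h

/-- The Jacobi sum of a cubic character of a field of characteristic `p` is not divisible by `p`. -/
theorem not_dvd_jacobiSum {F : Type*} [Field F] [Fintype F] {p m a b : ℕ} (hp : p.Prime)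
    (hb : p = 3 * b + 1) [CharP F p] (hF : Fintype.card F = p ^ m) (ha0 : 0 < a)
    (ha : Fintype.card F = 3 * a + 1) {χ : MulChar F Eis} {φ : Eis →+* F}
    (hφ : ∀ x, φ (χ x) = x ^ (2 * a)) : ¬ (p : Eis) ∣ jacobiSum χ χ := by
  rintro ⟨z, hz⟩
  have h0 : φ (jacobiSum χ χ) = 0 := by
    rw [hz, map_mul, map_natCast, CharP.cast_eq_zero, zero_mul]
  rw [jacobiSum, map_sum] at h0
  simp_rw [map_mul, hφ] at h0
  rw [sum_pow_mul_one_sub_pow F ha0 ha] at h0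
  have h1 : ((2 * a).choose a : F) = 0 := by
    refine (mul_eq_zero.mp h0).resolve_left ?_
    exact neg_ne_zero.mpr (pow_ne_zero _ (neg_ne_zero.mpr one_ne_zero))
  exact not_dvd_choose_two_mul hp hb m a (by rw [← hF, ha]) ((CharP.cast_eq_zero_iff F p _).mp h1)

/-! ### Complex embedding; norm and congruence of Jacobi sums -/

namespace Eis

open QuadraticAlgebra

/-- The complex number `(-1 + √3 i) / 2`. -/
noncomputable def omegaC : ℂ := ⟨-1 / 2, √3 / 2⟩

theorem omegaC_relation : omegaC ^ 2 + omegaC + 1 = 0 := by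
  have h3 : √3 * √3 = 3 := Real.mul_self_sqrt (by norm_num)
  apply Complex.ext
  · simp [omegaC, pow_two]; linear_combination (-1 / 4) * h3
  · simp [omegaC, pow_two]; ring

theorem conj_omegaC : (starRingEnd ℂ) omegaC = -1 - omegaC := by
  apply Complex.ext
  · simp [omegaC]; norm_num
  · simp [omegaC]

/-- The embedding of the Eisenstein integers into the complex numbers. -/
noncomputable def toComplex : Eis →+* ℂ := lift omegaC omegaC_relation

theorem toComplex_apply (z : Eis) : toComplex z = z.re + z.im * omegaC := lift_apply _ _ z

theorem toComplex_omega : toComplex ω = omegaC := lift_omega _ _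

theorem toComplex_star (z : Eis) : toComplex (star z) = (starRingEnd ℂ) (toComplex z) := by
  simp only [toComplex_apply, map_add, map_mul, conj_omegaC, map_intCast, re_star, im_star]
  push_cast
  ring

theorem toComplex_re (z : Eis) : (toComplex z).re = z.re - z.im / 2 := by
  simp [toComplex_apply, omegaC]; ring

theorem two_mul_toComplex_re (z : Eis) : 2 * (toComplex z).re = (trace z : ℤ) := by
  rw [toComplex_re, trace_def]; push_cast; ring

theorem toComplex_injective : Function.Injective toComplex := by
  rw [injective_iff_map_eq_zero]
  intro z hz
  apply eq_zero_of_norm_eq_zero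
  have : toComplex (z * star z) = 0 := by rw [map_mul, hz, zero_mul]
  rw [mul_star_self, map_intCast] at this
  exact_mod_cast this

end Eis

open Eis QuadraticAlgebra

theorem sq_ne_one_of_apply_eq_omega {F : Type*} [Field F] {χ : MulChar F Eis} {x₀ : F} (hx₀ : χ x₀ = ω) :
    χ ≠ 1 ∧ χ * χ ≠ 1 := by
  have hu : IsUnit x₀ := by
    by_contra h
    rw [χ.map_nonunit h] at hx₀
    simpa using congrArg QuadraticAlgebra.im hx₀
  constructor
  · rintro rfl
    rw [MulChar.one_apply hu] at hx₀
    simpa using congrArg QuadraticAlgebra.im hx₀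
  · intro h
    have h1 : (χ * χ) x₀ = 1 := by rw [h, MulChar.one_apply hu]
    rw [MulChar.mul_apply, hx₀] at h1
    simpa using congrArg QuadraticAlgebra.im h1

/-- This is |J|² = q, proved in ℂ, where inverting a character conjugates its Jacobi sum. -/
theorem norm_jacobiSum {F : Type*} [Field F] [Fintype F] {χ : MulChar F Eis} {x₀ : F} (hx₀ : χ x₀ = ω) :
    (jacobiSum χ χ).norm = Fintype.card F := by
  obtain ⟨h1, h2⟩ := sq_ne_one_of_apply_eq_omega hx₀
  have h1' : χ.ringHomComp toComplex ≠ 1 :=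
    (MulChar.ringHomComp_ne_one_iff toComplex_injective).mpr h1
  have h2' : χ.ringHomComp toComplex * χ.ringHomComp toComplex ≠ 1 := by
    rw [← MulChar.ringHomComp_mul]
    exact (MulChar.ringHomComp_ne_one_iff toComplex_injective).mpr h2
  have hchar : ringChar ℂ ≠ ringChar F := by
    rw [ringChar.eq_zero]
    exact (CharP.ringChar_ne_zero_of_finite F).symm
  have h := jacobiSum_mul_jacobiSum_inv hchar h1' h1' h2'
  have h3 : jacobiSum (χ.ringHomComp toComplex)⁻¹ (χ.ringHomComp toComplex)⁻¹
      = (starRingEnd ℂ) (jacobiSum (χ.ringHomComp toComplex) (χ.ringHomComp toComplex)) := by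
    simp only [jacobiSum, map_sum, map_mul, ← MulChar.star_apply', starRingEnd_apply]
  rw [h3, jacobiSum_ringHomComp, ← toComplex_star, ← map_mul, mul_star_self, map_intCast] at h
  exact_mod_cast h

theorem jacobiSum_primary {F : Type*} [Field F] [Fintype F] {χ : MulChar F Eis} (hχ : χ ^ 3 = 1) {a : ℕ}
    (ha : Fintype.card F = 3 * a + 1) :
    3 ∣ (jacobiSum χ χ).im ∧ toZModThree (jacobiSum χ χ) = -1 := by
  obtain ⟨z, -, hz⟩ := exists_jacobiSum_eq_neg_one_add (n := 3) (by norm_num) hχ hχ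
    ⟨a, by omega⟩ isPrimitiveRoot_omega
  -- J ≡ -1 modulo (ω - 1)², and (ω - 1)² = -3ω.
  have h : jacobiSum χ χ = -1 + ((3 : ℕ) : Eis) * (-(z * ω)) := by
    rw [hz]; push_cast; linear_combination z * omega_relation
  constructor
  · rw [h]
    simp only [im_add, im_neg, QuadraticAlgebra.im_one, im_mul, re_natCast, im_natCast]
    exact ⟨-(z * ω).im, by simp⟩
  · rw [h, map_add, map_mul, map_natCast, map_neg, map_one]
    have : ((3 : ℕ) : ZMod 3) = 0 := by decide
    rw [this, zero_mul, add_zero]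

/-! ### Cubic Gauss sums and Gaussian periods -/

section GaussSum

variable {F : Type*} [Field F] {χ : MulChar F Eis} {ψ : AddChar F ℂ}

theorem apply_neg_one (hχ : χ ^ 3 = 1) : χ (-1) = 1 := by
  have h1 : χ (-1) ^ 3 = 1 := by
    rw [← MulChar.pow_apply' χ (by norm_num), hχ, MulChar.one_apply isUnit_one.neg]
  have h2 : χ (-1) ^ 2 = 1 := by rw [← map_pow]; simp
  rw [← h1, pow_succ, h2, one_mul]

theorem ringHomComp_apply_neg_one (hχ : χ ^ 3 = 1) : (χ.ringHomComp toComplex) (-1) = 1 := by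
  rw [MulChar.ringHomComp_apply, apply_neg_one hχ, map_one]

open Classical in
/-- The indicator function of the nonzero cubes in terms of a cubic character. -/
theorem three_mul_indicator (hχ : χ ^ 3 = 1)
    (hcube : ∀ x, x ≠ 0 → (χ x = 1 ↔ x ∈ nonzeroPowers F 3)) (x : F) :
    3 * (if x ∈ nonzeroPowers F 3 then (1 : ℂ) else 0)
      = (1 : MulChar F ℂ) x + χ.ringHomComp toComplex x + (χ.ringHomComp toComplex)⁻¹ x := by
  by_cases hx : x = 0
  · subst hx
    rw [if_neg, MulChar.map_zero, MulChar.map_zero, MulChar.map_zero]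
    · simp
    · rintro ⟨y, hy, h⟩
      exact hy (eq_zero_of_pow_eq_zero h)
  · have hu : IsUnit x := isUnit_iff_ne_zero.mpr hx
    have h3 : χ.ringHomComp toComplex x ^ 3 = 1 := by
      rw [← MulChar.pow_apply' _ (by norm_num), MulChar.ringHomComp_pow, hχ,
        MulChar.ringHomComp_one, MulChar.one_apply hu]
    have hinv : (χ.ringHomComp toComplex)⁻¹ x = χ.ringHomComp toComplex x ^ 2 := by
      rw [MulChar.inv_apply_eq_inv', inv_eq_of_mul_eq_one_right]
      rw [← h3]; ring
    rw [hinv, MulChar.one_apply hu]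
    by_cases hm : x ∈ nonzeroPowers F 3
    · rw [if_pos hm, MulChar.ringHomComp_apply, (hcube x hx).mpr hm, map_one]
      norm_num
    · rw [if_neg hm]
      have hne : χ.ringHomComp toComplex x - 1 ≠ 0 := by
        rw [sub_ne_zero, MulChar.ringHomComp_apply]
        intro h
        exact hm ((hcube x hx).mp (toComplex_injective (by rw [h, map_one])))
      apply mul_left_cancel₀ hne
      linear_combination -h3

variable [Fintype F]

theorem gaussSum_pow_three (hχ : χ ^ 3 = 1) {x₀ : F} (hx₀ : χ x₀ = ω) (hψ : ψ.IsPrimitive) :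
    gaussSum (χ.ringHomComp toComplex) ψ ^ 3 = Fintype.card F * toComplex (jacobiSum χ χ) := by
  have h1 : χ.ringHomComp toComplex ≠ 1 :=
    (MulChar.ringHomComp_ne_one_iff toComplex_injective).mpr (sq_ne_one_of_apply_eq_omega hx₀).1
  have hord : orderOf (χ.ringHomComp toComplex) = 3 := by
    refine orderOf_eq_prime ?_ h1
    rw [MulChar.ringHomComp_pow, hχ, MulChar.ringHomComp_one]
  have h := gaussSum_pow_eq_prod_jacobiSum (χ := χ.ringHomComp toComplex) (by omega) hψ
  rw [hord, ringHomComp_apply_neg_one hχ] at h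
  rw [h]
  simp [jacobiSum_ringHomComp]

/-- Conjugation inverts both χ and ψ; undoing the inversion of ψ costs a factor χ(-1) = 1. -/
theorem gaussSum_inv_eq_conj (hχ : χ ^ 3 = 1) :
    gaussSum (χ.ringHomComp toComplex)⁻¹ ψ
      = (starRingEnd ℂ) (gaussSum (χ.ringHomComp toComplex) ψ) := by
  have h := mul_gaussSum_inv_eq_gaussSum (χ.ringHomComp toComplex)⁻¹ ψ
  rw [MulChar.inv_apply', inv_neg, inv_one, ringHomComp_apply_neg_one hχ, one_mul] at h
  rw [← h, starRingEnd_apply, star_gaussSum_eq]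

open Classical in
/-- The cubic Gaussian periods in terms of the cubic Gauss sum. -/
theorem sum_indicator_mul_addChar (hχ : χ ^ 3 = 1)
    (hcube : ∀ x, x ≠ 0 → (χ x = 1 ↔ x ∈ nonzeroPowers F 3)) (hψ : ψ.IsPrimitive)
    {c : F} (hc : c ≠ 0) :
    ∑ x, (if x ∈ nonzeroPowers F 3 then (1 : ℂ) else 0) * ψ (x * c)
      = (((2 * ((starRingEnd ℂ) (toComplex (χ c)) *
          gaussSum (χ.ringHomComp toComplex) ψ).re - 1) / 3 : ℝ) : ℂ) := by
  have hψc : ψ.mulShift c ≠ 1 := hψ hc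
  have h1 := gaussSum_one_left (R' := ℂ) hψc
  have h2 := gaussSum_mulShift_eq (χ.ringHomComp toComplex) ψ (Units.mk0 c hc)
  have h3 := gaussSum_mulShift_eq (χ.ringHomComp toComplex)⁻¹ ψ (Units.mk0 c hc)
  rw [gaussSum_inv_eq_conj hχ (ψ := ψ), inv_inv] at h3
  rw [← MulChar.star_apply'] at h2
  simp only [Units.val_mk0, MulChar.ringHomComp_apply, ← starRingEnd_apply] at h2 h3
  have hs : 3 * ∑ x, (if x ∈ nonzeroPowers F 3 then (1 : ℂ) else 0) * ψ (x * c)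
      = gaussSum 1 (ψ.mulShift c) + gaussSum (χ.ringHomComp toComplex) (ψ.mulShift c)
        + gaussSum (χ.ringHomComp toComplex)⁻¹ (ψ.mulShift c) := by
    simp only [gaussSum, ← sum_add_distrib, mul_sum, AddChar.mulShift_apply]
    refine sum_congr rfl fun x _ => ?_
    rw [← mul_assoc, three_mul_indicator hχ hcube, mul_comm x c]
    ring
  rw [h1, h2, h3] at hs
  have h4 := Complex.add_conj ((starRingEnd ℂ) (toComplex (χ c)) *
    gaussSum (χ.ringHomComp toComplex) ψ)
  rw [map_mul, Complex.conj_conj] at h4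
  push_cast at h4 ⊢
  linear_combination (1 / 3) * hs + (1 / 3) * h4

open Classical in
theorem sum_indicator_nonzeroPowers {x₀ : F} (hx₀ : χ x₀ = ω) (hχ : χ ^ 3 = 1)
    (hcube : ∀ x, x ≠ 0 → (χ x = 1 ↔ x ∈ nonzeroPowers F 3)) {a : ℕ}
    (ha : Fintype.card F = 3 * a + 1) :
    ∑ x, (if x ∈ nonzeroPowers F 3 then (1 : ℂ) else 0) = a := by
  have h1 : χ.ringHomComp toComplex ≠ 1 :=
    (MulChar.ringHomComp_ne_one_iff toComplex_injective).mpr (sq_ne_one_of_apply_eq_omega hx₀).1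
  have hs : 3 * ∑ x : F, (if x ∈ nonzeroPowers F 3 then (1 : ℂ) else 0) = 3 * a := by
    rw [mul_sum]
    simp_rw [three_mul_indicator hχ hcube, sum_add_distrib]
    rw [MulChar.sum_eq_zero_of_ne_one h1, MulChar.sum_eq_zero_of_ne_one (inv_ne_one.mpr h1),
      MulChar.sum_one_eq_card_units, Fintype.card_units, ha]
    simp
  linear_combination (1 / 3) * hs

end GaussSum

/-! ### Spectra and energies -/

open Classical in
/-- The spectrum of a Cayley graph on the additive group of a finite field is given by the additive
characters. -/
theorem spec_eq_map {F : Type*} [Field F] [Fintype F] {ψ : AddChar F ℂ} (hψ : ψ.IsPrimitive)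
    (G : SimpleGraph F) (f : F → ℝ) (hf : ∀ u v, f (v - u) = if G.Adj u v then 1 else 0)
    (μ : F → ℝ) (hμ : ∀ c, (μ c : ℂ) = ∑ x, (f x : ℂ) * ψ (x * c)) :
    spec G = (univ : Finset F).val.map μ := by
  have hspec : spec G = (G.adjMatrix ℝ).charpoly.roots := by
    unfold spec
    congr!
  rw [hspec]
  set M := G.adjMatrix ℝ with hM
  -- P is the character table and Q its inverse; P diagonalizes M over ℂ, and the characteristic
  -- polynomial is then brought back to ℝ.
  let P : Matrix F F ℂ := Matrix.of fun u c => ψ (u * c)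
  let Q : Matrix F F ℂ := Matrix.of fun c u => (Fintype.card F : ℂ)⁻¹ * ψ (c * (-u))
  have hq : (Fintype.card F : ℂ) ≠ 0 := by exact_mod_cast Fintype.card_ne_zero
  have hPQ : P * Q = 1 := by
    ext u w
    simp only [Matrix.mul_apply, P, Q, Matrix.of_apply, Matrix.one_apply]
    have h := AddChar.sum_mulShift (u - w) hψ
    have h' : ∀ c, ψ (u * c) * ((Fintype.card F : ℂ)⁻¹ * ψ (c * (-w)))
        = (Fintype.card F : ℂ)⁻¹ * ψ (c * (u - w)) := by
      intro c
      rw [show c * (u - w) = u * c + c * (-w) by ring, AddChar.map_add_eq_mul]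
      ring
    simp_rw [h', ← mul_sum, h, sub_eq_zero]
    split_ifs <;> simp [hq]
  have hMP : M.map (algebraMap ℝ ℂ) * P = P * Matrix.diagonal (fun c => (μ c : ℂ)) := by
    ext u c
    rw [Matrix.mul_diagonal, Matrix.mul_apply, hμ, mul_sum]
    refine Fintype.sum_equiv (Equiv.subRight u) _ _ fun v => ?_
    simp only [hM, P, Matrix.of_apply, Matrix.map_apply, SimpleGraph.adjMatrix_apply,
      Equiv.subRight_apply, ← hf]
    rw [show v * c = u * c + (v - u) * c by ring, AddChar.map_add_eq_mul]
    simp only [Complex.coe_algebraMap]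
    ring
  have hchar : (M.map (algebraMap ℝ ℂ)).charpoly
      = ∏ c, (Polynomial.X - Polynomial.C (μ c : ℂ)) := by
    have : M.map (algebraMap ℝ ℂ) = (P * Matrix.diagonal (fun c => (μ c : ℂ))) * Q := by
      rw [← hMP, mul_assoc, hPQ, mul_one]
    rw [this, Matrix.charpoly_mul_comm, ← mul_assoc, mul_eq_one_comm.mp hPQ, one_mul,
      Matrix.charpoly_diagonal]
  have hreal : M.charpoly = ((univ.val.map μ).map fun r => Polynomial.X - Polynomial.C r).prod := by
    apply Polynomial.map_injective (algebraMap ℝ ℂ) (algebraMap ℝ ℂ).injective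
    rw [← Matrix.charpoly_map, hchar, Multiset.map_map]
    change _ = Polynomial.map _ (∏ c, (Polynomial.X - Polynomial.C (μ c)))
    simp [Polynomial.map_prod]
  rw [hreal, Polynomial.roots_multiset_prod_X_sub_C]

/-- If `Y` is three times an eigenvalue plus one, this is the difference between the absolute value
of the eigenvalue and of the corresponding eigenvalue of the complement. -/
noncomputable def absDiff (y : ℝ) : ℝ := |(y - 1) / 3| - |-1 - (y - 1) / 3|

theorem absDiff_of_one_le {y : ℝ} (h : 1 ≤ y) : absDiff y = -1 := by
  rw [absDiff, abs_of_nonneg (by linarith), abs_of_nonpos (by linarith)]; ring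

theorem absDiff_of_le_neg_two {y : ℝ} (h : y ≤ -2) : absDiff y = 1 := by
  rw [absDiff, abs_of_nonpos (by linarith), abs_of_nonneg (by linarith)]; ring

theorem absDiff_mul_of_pos {N : ℕ} (hN : 2 ≤ N) {t : ℤ} (ht : 0 < t) :
    absDiff (N * t) = -1 := by
  apply absDiff_of_one_le
  have h : (1 : ℤ) ≤ N * t := by nlinarith
  exact_mod_cast h

/-- Here N ≥ 2 is essential: it keeps y out of the interval (-2, 1), on which `absDiff` is not ±1.
-/
theorem absDiff_mul_of_neg {N : ℕ} (hN : 2 ≤ N) {t : ℤ} (ht : t < 0) :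
    absDiff (N * t) = 1 := by
  apply absDiff_of_le_neg_two
  have h : (N : ℤ) * t ≤ -2 := by nlinarith
  exact_mod_cast h

theorem absDiff_sum_eq_one {N : ℕ} (hN : 2 ≤ N) {r s t : ℤ} (hsum : r + s + t = 0)
    (hprod : 0 < r * s * t) : absDiff (N * r) + absDiff (N * s) + absDiff (N * t) = 1 := by
  rcases lt_trichotomy r 0 with hr | rfl | hr
  · rcases lt_trichotomy s 0 with hs | rfl | hs
    · rw [absDiff_mul_of_neg hN hr, absDiff_mul_of_neg hN hs, absDiff_mul_of_pos hN (by omega)]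
      norm_num
    · simp at hprod
    · have ht : t < 0 := by nlinarith [mul_pos (neg_pos.mpr hr) hs]
      rw [absDiff_mul_of_neg hN hr, absDiff_mul_of_pos hN hs, absDiff_mul_of_neg hN ht]
      norm_num
  · simp at hprod
  · rcases lt_trichotomy s 0 with hs | rfl | hs
    · have ht : t < 0 := by nlinarith [mul_pos hr (neg_pos.mpr hs)]
      rw [absDiff_mul_of_pos hN hr, absDiff_mul_of_neg hN hs, absDiff_mul_of_neg hN ht]
      norm_num
    · simp at hprod
    · nlinarith [mul_pos hr hs]

/-- The cube roots of unity lie in ℤ[ω], so every cube root of (Nτ)³ is again N times an Eisenstein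
integer. -/
theorem exists_eq_mul_toComplex_of_pow_three_eq {G : ℂ} {N : ℕ} {τ : Eis}
    (h : G ^ 3 = (N * toComplex τ) ^ 3) : ∃ σ : Eis, G = N * toComplex σ ∧ σ ^ 3 = τ ^ 3 := by
  have hw := omegaC_relation
  have hfac : (G - N * toComplex τ) * ((G - N * (omegaC * toComplex τ)) *
      (G - N * (omegaC ^ 2 * toComplex τ))) = 0 := by
    linear_combination h + (-G ^ 2 * (N * toComplex τ) + G * (N * toComplex τ) ^ 2 * omegaC
      - (omegaC - 1) * (N * toComplex τ) ^ 3) * hw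
  rcases mul_eq_zero.mp hfac with h | h
  · exact ⟨τ, sub_eq_zero.mp h, rfl⟩
  · rcases mul_eq_zero.mp h with h | h
    · refine ⟨ω * τ, ?_, ?_⟩
      · rw [map_mul, toComplex_omega]; exact sub_eq_zero.mp h
      · rw [mul_pow, omega_pow_three, one_mul]
    · refine ⟨ω ^ 2 * τ, ?_, ?_⟩
      · rw [map_mul, map_pow, toComplex_omega]; exact sub_eq_zero.mp h
      · rw [mul_pow, ← pow_mul, mul_comm 2 3, pow_mul, omega_pow_three, one_pow, one_mul]

/-- The traces of σ, ω̄σ, ω̄²σ have sum 0 since 1 + ω̄ + ω̄² = 0, and product Tr(σ³). -/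
theorem absDiff_conjugates {G : ℂ} {N : ℕ} (hN : 2 ≤ N) {τ : Eis}
    (h : G ^ 3 = (N * toComplex τ) ^ 3) (hτ : 0 < trace (τ ^ 3)) :
    absDiff (2 * G.re) + absDiff (2 * ((starRingEnd ℂ) omegaC * G).re)
      + absDiff (2 * ((starRingEnd ℂ) omegaC * ((starRingEnd ℂ) omegaC * G)).re) = 1 := by
  obtain ⟨σ, rfl, hσ⟩ := exists_eq_mul_toComplex_of_pow_three_eq h
  rw [← hσ] at hτ
  have key : ∀ z : Eis, 2 * ((N : ℂ) * toComplex z).re = N * (trace z : ℤ) := by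
    intro z
    rw [← two_mul_toComplex_re, ← Complex.ofReal_natCast, Complex.re_ofReal_mul]
    ring
  have e1 : (starRingEnd ℂ) omegaC * (N * toComplex σ) = N * toComplex (star ω * σ) := by
    rw [map_mul, toComplex_star, toComplex_omega]; ring
  have e2 : (starRingEnd ℂ) omegaC * (N * toComplex (star ω * σ))
      = N * toComplex (star ω * (star ω * σ)) := by
    rw [map_mul toComplex (star ω) (star ω * σ), toComplex_star, toComplex_omega]; ring
  rw [e1, e2, key, key, key]
  apply absDiff_sum_eq_one hN
  · simp [trace_def]; ring
  · refine hτ.trans_eq ?_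
    simp [trace_def, pow_succ]; ring

open Classical in
theorem gpGraph_spectra {F : Type*} [Field F] [Fintype F] {a : ℕ}
    (ha : Fintype.card F = 3 * a + 1) {χ : MulChar F Eis} (hχ : χ ^ 3 = 1) {x₀ : F}
    (hx₀ : χ x₀ = ω) (hcube : ∀ x, x ≠ 0 → (χ x = 1 ↔ x ∈ nonzeroPowers F 3))
    {ψ : AddChar F ℂ} (hψ : ψ.IsPrimitive) :
    let μ : F → ℝ := fun c => if c = 0 then (a : ℝ) else
      (2 * ((starRingEnd ℂ) (toComplex (χ c)) * gaussSum (χ.ringHomComp toComplex) ψ).re - 1) / 3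
    spec (gpGraph F 3) = (univ : Finset F).val.map μ ∧
      spec (gpGraph F 3)ᶜ
        = (univ : Finset F).val.map (fun c => if c = 0 then (2 * a : ℝ) else -1 - μ c) ∧
      ∀ c, |μ c| ≤ a := by
  intro μ
  set f : F → ℝ := fun x => if x ∈ nonzeroPowers F 3 then 1 else 0 with hf
  have hfc : ∀ x, (f x : ℂ) = if x ∈ nonzeroPowers F 3 then 1 else 0 := by
    intro x
    simp only [hf]
    split_ifs <;> simp
  have h0 : (0 : F) ∉ nonzeroPowers F 3 := by
    rintro ⟨y, hy, h⟩
    exact hy (eq_zero_of_pow_eq_zero h)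
  have hμ : ∀ c, (μ c : ℂ) = ∑ x, (f x : ℂ) * ψ (x * c) := by
    intro c
    simp_rw [hfc]
    simp only [μ]
    split_ifs with hc
    · subst hc
      simp only [mul_zero, AddChar.map_zero_eq_one, mul_one]
      rw [sum_indicator_nonzeroPowers hx₀ hχ hcube ha]
      simp
    · rw [sum_indicator_mul_addChar hχ hcube hψ hc]
  refine ⟨?_, ?_, ?_⟩
  · refine spec_eq_map hψ _ f (fun u v => ?_) μ hμ
    simp only [hf, gpGraph_adj_iff_of_odd F (show Odd 3 by decide)]
  -- The complement's connection set is everything except the cubes and 0; the constant 1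
  -- contributes only at c = 0.
  · refine spec_eq_map hψ _ (fun x => (1 - f x) - if x = 0 then 1 else 0) (fun u v => ?_) _ ?_
    · simp only [hf, SimpleGraph.compl_adj, gpGraph_adj_iff_of_odd F (show Odd 3 by decide),
        sub_eq_zero]
      by_cases huv : v = u
      · subst huv
        simp [h0]
      · by_cases h : v - u ∈ nonzeroPowers F 3
        · simp [h, huv]
        · simp [h, huv, Ne.symm huv]
    · intro c
      have h1 : ∀ x, (((1 - f x) - if x = 0 then 1 else 0 : ℝ) : ℂ) * ψ (x * c)
          = ψ (x * c) - (f x : ℂ) * ψ (x * c) - if x = 0 then 1 else 0 := by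
        intro x
        by_cases hx : x = 0
        · subst hx; simp
        · simp [hx]; ring
      simp_rw [h1, sum_sub_distrib, ← hμ, AddChar.sum_mulShift c hψ]
      by_cases hc : c = 0
      · simp [hc, ha, μ]; ring
      · simp [hc]; ring
  · intro c
    have h1 : |μ c| = ‖(μ c : ℂ)‖ := by simp
    have h2 : ((∑ x, f x : ℝ) : ℂ) = a := by
      rw [← sum_indicator_nonzeroPowers hx₀ hχ hcube ha]
      simp [hf]
    have h2' : ∑ x, f x = a := by exact_mod_cast h2
    rw [h1, hμ, ← h2']
    refine (norm_sum_le _ _).trans (sum_le_sum fun x _ => ?_)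
    have : ‖ψ (x * c)‖ = 1 := AddChar.norm_apply ψ _
    rw [norm_mul, this, mul_one, Complex.norm_real, Real.norm_of_nonneg]
    simp only [hf]
    split_ifs <;> norm_num

theorem equienergetic_and_not_isospectral {F : Type*} [Field F] [Fintype F] {a N : ℕ} (ha0 : 0 < a)
    (ha : Fintype.card F = 3 * a + 1) (hN : 2 ≤ N) (hFN : Fintype.card F = N ^ 3)
    {χ : MulChar F Eis} (hχ : χ ^ 3 = 1) {x₀ : F} (hx₀ : χ x₀ = ω)
    (hcube : ∀ x, x ≠ 0 → (χ x = 1 ↔ x ∈ nonzeroPowers F 3)) {τ : Eis}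
    (hJ : jacobiSum χ χ = τ ^ 3) (hτ : 0 < trace (τ ^ 3)) :
    Equienergetic (gpGraph F 3) (gpGraph F 3)ᶜ ∧ ¬ Isospectral (gpGraph F 3) (gpGraph F 3)ᶜ := by
  classical
  obtain ⟨ψ, hψ⟩ : ∃ ψ : AddChar F ℂ, ψ.IsPrimitive :=
    ⟨_, AddChar.FiniteField.primitiveChar_to_Complex_isPrimitive F⟩
  obtain ⟨h1, h2, h3⟩ := gpGraph_spectra ha hχ hx₀ hcube hψ
  set g := gaussSum (χ.ringHomComp toComplex) ψ with hg
  have hg3 : g ^ 3 = (N * toComplex τ) ^ 3 := by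
    rw [hg, gaussSum_pow_three hχ hx₀ hψ, hJ, hFN, map_pow]; push_cast; ring
  constructor
  · refine ⟨rfl, ?_⟩
    have hx₀0 : x₀ ≠ 0 := by
      rintro rfl
      rw [MulChar.map_zero] at hx₀
      simpa using congrArg QuadraticAlgebra.im hx₀
    set H : F → ℝ := fun c => if c = 0 then 0 else
      absDiff (2 * ((starRingEnd ℂ) (toComplex (χ c)) * g).re) with hH
    -- As χ(x₀) = ω, the elements c, x₀c, x₀²c meet all three cubic classes. Averaging over such
    -- triples gives ∑ H = (q - 1)/3 = a, exactly the gap between the trivial eigenvalues a and 2a.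
    have hshift : ∀ c, c ≠ 0 → H c + H (x₀ * c) + H (x₀ * (x₀ * c)) = 1 := by
      intro c hc
      simp only [hH, mul_eq_zero, hc, hx₀0, or_self, if_false, map_mul, hx₀, toComplex_omega,
        mul_assoc]
      refine absDiff_conjugates hN ?_ hτ
      have hc3 : χ c ^ 3 = 1 := by
        rw [← MulChar.pow_apply' χ (by norm_num), hχ,
          MulChar.one_apply (isUnit_iff_ne_zero.mpr hc)]
      rw [mul_pow, ← map_pow, ← map_pow, hc3, map_one, map_one, one_mul, hg3]
    have hinv : ∀ K : F → ℝ, ∑ c, K (x₀ * c) = ∑ c, K c := fun K =>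
      Equiv.sum_comp (Equiv.mulLeft₀ x₀ hx₀0) K
    have hsum : ∑ c, H c = a := by
      have h3H : 3 * ∑ c, H c = ∑ c, (H c + H (x₀ * c) + H (x₀ * (x₀ * c))) := by
        rw [sum_add_distrib, sum_add_distrib, hinv (fun c => H (x₀ * c)), hinv H]
        ring
      have h1 : ∑ c, (H c + H (x₀ * c) + H (x₀ * (x₀ * c)))
          = ∑ c : F, ((1 : ℝ) - if c = 0 then 1 else 0) := by
        refine sum_congr rfl fun c _ => ?_
        by_cases hc : c = 0
        · simp [hc, hH]
        · rw [hshift c hc, if_neg hc, sub_zero]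
      rw [h1, sum_sub_distrib] at h3H
      simp [ha] at h3H
      linarith
    unfold energy
    rw [h1, h2, Multiset.map_map, Multiset.map_map, ← sub_eq_zero]
    change (∑ c, _) - (∑ c, _) = 0
    rw [← sum_sub_distrib]
    rw [← sub_eq_zero.mpr hsum]
    have h5 : (a : ℝ) = ∑ c : F, if c = 0 then (a : ℝ) else 0 := by simp
    conv_rhs => rw [h5, ← sum_sub_distrib]
    refine sum_congr rfl fun c _ => ?_
    by_cases hc : c = 0
    · simp only [hc, hH, Function.comp, if_true]
      rw [abs_of_nonneg (by positivity), abs_of_nonneg (by positivity)]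
      ring
    · simp only [hc, hH, Function.comp, if_false, absDiff, sub_zero]
  · intro hiso
    rw [Isospectral, h1, h2] at hiso
    have hmem : (2 * a : ℝ) ∈ (univ : Finset F).val.map (fun c => if c = 0 then (2 * a : ℝ) else
        -1 - (if c = 0 then (a : ℝ) else
          (2 * ((starRingEnd ℂ) (toComplex (χ c)) * g).re - 1) / 3)) :=
      Multiset.mem_map.mpr ⟨0, mem_univ_val _, by simp⟩
    rw [← hiso] at hmem
    obtain ⟨c, -, hc⟩ := Multiset.mem_map.mp hmem
    have h4 := (le_abs_self _).trans (h3 c)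
    simp only at h4
    rw [hc] at h4
    have : (0 : ℝ) < a := by exact_mod_cast ha0
    linarith

/-! ### Powers on the unit circle and half planes -/

theorem abs_re_sum_mul_pow_le {v w : ℂ} (hv : ‖v‖ = 1) (hw : ‖w‖ = 1) (hw1 : w ≠ 1) (n : ℕ) :
    |∑ k ∈ range n, (v * w ^ k).re| ≤ 2 / ‖w - 1‖ := by
  rw [← Complex.re_sum, ← mul_sum, geom_sum_eq hw1]
  refine (Complex.abs_re_le_norm _).trans ?_
  rw [norm_mul, hv, one_mul, norm_div]
  gcongr
  refine (norm_sub_le _ _).trans ?_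
  rw [norm_pow, hw, one_pow, NormOneClass.norm_one]
  norm_num

/-- The powers of a number on the unit circle other than `1` and `-1` do not stay in a half plane. -/
theorem exists_re_mul_pow_pos {v w : ℂ} (hv : ‖v‖ = 1) (hw : ‖w‖ = 1) (hw2 : w ^ 2 ≠ 1) :
    ∃ k : ℕ, 0 < (v * w ^ k).re := by
  by_contra! hcon
  have hw1 : w ≠ 1 := by rintro rfl; simp at hw2
  have hv2 : ‖v ^ 2‖ = 1 := by rw [norm_pow, hv, one_pow]
  have hww2 : ‖w ^ 2‖ = 1 := by rw [norm_pow, hw, one_pow]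
  -- If |x| = 1 and Re x ≤ 0, then -Re x ≥ (Re x)² = (1 + Re x²)/2. Summed over k < n, this bounds
  -- n/2 by geometric sums that stay bounded.
  have hpt : ∀ k : ℕ, 1 / 2 + (v ^ 2 * (w ^ 2) ^ k).re / 2 ≤ -(v * w ^ k).re := by
    intro k
    set x := v * w ^ k with hx
    have hxn : ‖x‖ = 1 := by rw [hx, norm_mul, norm_pow, hv, hw]; simp
    have hsq : x.re ^ 2 + x.im ^ 2 = 1 := by
      have h := Complex.sq_norm x
      rw [hxn, Complex.normSq_apply] at h
      linarith
    have h2 : v ^ 2 * (w ^ 2) ^ k = x ^ 2 := by rw [hx]; ring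
    have h3 : (x ^ 2).re = x.re ^ 2 - x.im ^ 2 := by rw [pow_two, Complex.mul_re]; ring
    rw [h2, h3]
    have h4 : x.re ≤ 0 := hcon k
    nlinarith [sq_nonneg x.im]
  obtain ⟨n, hn⟩ := exists_nat_gt (2 * (2 / ‖w - 1‖ + (2 / ‖w ^ 2 - 1‖) / 2))
  have hsum := sum_le_sum fun k (_ : k ∈ range n) => hpt k
  rw [sum_add_distrib, sum_neg_distrib, ← sum_div _ fun k => (v ^ 2 * (w ^ 2) ^ k).re, sum_const,
    card_range, nsmul_eq_mul] at hsum
  have h1 := abs_le.mp (abs_re_sum_mul_pow_le hv hw hw1 n)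
  have h2 := abs_le.mp (abs_re_sum_mul_pow_le hv2 hww2 hw2 n)
  linarith [h1.1, h2.1]

theorem infinite_setOf_re_mul_pow_pos {v w : ℂ} (hv : v ≠ 0) (hw : w.im ≠ 0) :
    {k : ℕ | 0 < (v * w ^ k).re}.Infinite := by
  have hw0 : w ≠ 0 := by rintro rfl; simp at hw
  have hwn : 0 < ‖w‖ := norm_pos_iff.mpr hw0
  rw [Set.infinite_iff_exists_gt]
  intro n
  have hvn : 0 < ‖v * w ^ (n + 1)‖ := norm_pos_iff.mpr (mul_ne_zero hv (pow_ne_zero _ hw0))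
  -- Starting the sequence at exponent n + 1 makes the exponent found exceed n.
  set c := v * w ^ (n + 1) with hc
  have hne : (w / ‖w‖ : ℂ) ^ 2 ≠ 1 := by
    intro h
    have h1 : (w / ‖w‖ : ℂ).im = 0 := by
      rcases sq_eq_sq_iff_eq_or_eq_neg.mp (h.trans (one_pow 2).symm) with h | h <;> simp [h]
    rw [Complex.div_ofReal_im, div_eq_zero_iff] at h1
    exact h1.elim hw hwn.ne'
  obtain ⟨k, hk⟩ := exists_re_mul_pow_pos (v := c / ‖c‖) (w := w / ‖w‖)
    (by rw [norm_div, Complex.norm_real, norm_norm, div_self hvn.ne'])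
    (by rw [norm_div, Complex.norm_real, norm_norm, div_self hwn.ne']) hne
  refine ⟨n + 1 + k, ?_, by omega⟩
  have h2 : v * w ^ (n + 1 + k)
      = ((‖c‖ * ‖w‖ ^ k : ℝ) : ℂ) * (c / ‖c‖ * (w / ‖w‖) ^ k) := by
    have h3 : (‖c‖ : ℂ) ≠ 0 := by exact_mod_cast hvn.ne'
    have h4 : (‖w‖ : ℂ) ≠ 0 := by exact_mod_cast hwn.ne'
    push_cast
    rw [div_pow]
    field_simp
    rw [hc]; ring
  rw [Set.mem_ofPred_eq, h2, Complex.re_ofReal_mul]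
  positivity

/-! ### Sign of the trace and conclusion -/

/-- The properties of the cubic Jacobi sum that determine it up to conjugation. -/
structure IsPrimaryOfNorm (p m : ℕ) (J : Eis) : Prop where
  norm_eq : J.norm = p ^ m
  three_dvd_im : 3 ∣ J.im
  toZModThree_eq : toZModThree J = -1
  not_dvd : ¬ (p : Eis) ∣ J

theorem exists_cubicChar_isPrimaryOfNorm (F : Type*) [Field F] [Fintype F] {p m b : ℕ}
    (hp : p.Prime) (hb : p = 3 * b + 1) [CharP F p] (hF : Fintype.card F = p ^ m) :
    ∃ (a : ℕ) (χ : MulChar F Eis) (x₀ : F), 0 < a ∧ Fintype.card F = 3 * a + 1 ∧ χ ^ 3 = 1 ∧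
      χ x₀ = ω ∧ (∀ x, x ≠ 0 → (χ x = 1 ↔ x ∈ nonzeroPowers F 3)) ∧
      IsPrimaryOfNorm p m (jacobiSum χ χ) := by
  obtain ⟨a, ha⟩ : ∃ a, Fintype.card F = 3 * a + 1 := by
    have h1 : p ^ m % 3 = 1 := by
      rw [Nat.pow_mod, show p % 3 = 1 by omega]; simp
    exact ⟨p ^ m / 3, by omega⟩
  have ha0 : 0 < a := by have := Fintype.one_lt_card (α := F); omega
  obtain ⟨χ, φ, hχ, ⟨x₀, hx₀⟩, hcube, hφ⟩ := exists_cubicChar F ha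
  obtain ⟨h3, h1⟩ := jacobiSum_primary hχ ha
  refine ⟨a, χ, x₀, ha0, ha, hχ, hx₀, hcube, ?_, h3, h1, not_dvd_jacobiSum hp hb hF ha0 ha hφ⟩
  rw [norm_jacobiSum hx₀, hF]; push_cast; rfl

theorem exists_isPrimaryOfNorm {p b m : ℕ} [hp : Fact p.Prime] (hb : p = 3 * b + 1) (hm : m ≠ 0) :
    ∃ J : Eis, IsPrimaryOfNorm p m J := by
  let := Fintype.ofFinite (GaloisField p m)
  obtain ⟨-, χ, -, -, -, -, -, -, h⟩ := exists_cubicChar_isPrimaryOfNorm (GaloisField p m) hp.out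
    hb (by rw [← Nat.card_eq_fintype_card, GaloisField.card p m hm])
  exact ⟨_, h⟩

theorem IsPrimaryOfNorm.eq_pow {p m : ℕ} (hp : p.Prime) (hp3 : p ≠ 3) {π J : Eis}
    (hπ : IsPrimaryOfNorm p 1 π) (hJ : IsPrimaryOfNorm p m J) :
    ∃ ρ ∈ ({π, star π} : Set Eis), J = (-1) ^ (m + 1) * ρ ^ m :=
  eq_neg_one_pow_mul_pow hp hp3 (by rw [hπ.norm_eq, pow_one]) hπ.three_dvd_im hπ.toZModThree_eq
    hJ.norm_eq hJ.three_dvd_im hJ.toZModThree_eq hJ.not_dvd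

/-- Otherwise π^(2k) = p^k, and likewise for star π, so the Jacobi sum over the field with p^(2k)
elements would be ±p^k, contrary to its not being divisible by p. -/
theorem IsPrimaryOfNorm.pow_ne_star_pow {p b : ℕ} [hp : Fact p.Prime] (hb : p = 3 * b + 1) {π : Eis}
    (hπ : IsPrimaryOfNorm p 1 π) {k : ℕ} (hk : k ≠ 0) : π ^ k ≠ star π ^ k := by
  intro h
  obtain ⟨J, hJ⟩ := exists_isPrimaryOfNorm hb (show k + k ≠ 0 by omega)
  obtain ⟨ρ, hρ, hJρ⟩ := hπ.eq_pow hp.out (by omega) hJ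
  apply hJ.not_dvd
  have h1 : π * star π = (p : Eis) := by rw [mul_star_self, hπ.norm_eq]; simp
  have h2 : ρ ^ (k + k) = (p : Eis) ^ k := by
    rw [← h1, mul_pow, pow_add]
    rcases hρ with rfl | rfl <;> rw [h]
  rw [hJρ, h2]
  exact (dvd_pow_self _ hk).mul_left _

theorem infinite_setOf_trace_pos {p b : ℕ} [hp : Fact p.Prime] (hb : p = 3 * b + 1) {π : Eis}
    (hπ : IsPrimaryOfNorm p 1 π) {t : ℕ} (ht : 0 < t) (s : ℕ) :
    {l : ℕ | 0 < trace (((-1) ^ (t * l + s + 1) * π ^ (t * l + s)) ^ 3)}.Infinite := by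
  have hπ0 : π ≠ 0 := by
    rintro rfl
    exact hπ.not_dvd (dvd_zero _)
  have hz0 : toComplex (-π ^ 3) ≠ 0 := by
    rw [Ne, map_eq_zero_iff _ toComplex_injective]
    exact neg_ne_zero.mpr (pow_ne_zero _ hπ0)
  have him : (toComplex (-π ^ 3) ^ t).im ≠ 0 := by
    rw [← map_pow, Ne, ← Complex.conj_eq_iff_im, ← toComplex_star, toComplex_injective.eq_iff,
      star_pow, star_neg, star_pow, neg_pow, neg_pow (π ^ 3), ← pow_mul, ← pow_mul]
    intro h
    exact hπ.pow_ne_star_pow hb (show 3 * t ≠ 0 by omega)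
      (mul_left_cancel₀ (pow_ne_zero _ (neg_ne_zero.mpr one_ne_zero)) h).symm
  -- As (-1)³ = -1, τ³ equals -(-π³)^(tℓ+s): a geometric progression in ℓ with ratio (-π³)^t, which
  -- is not real.
  refine (infinite_setOf_re_mul_pow_pos (v := -toComplex (-π ^ 3) ^ s)
    (neg_ne_zero.mpr (pow_ne_zero _ hz0)) him).mono ?_
  intro l hl
  rw [Set.mem_ofPred_eq] at hl ⊢
  have h1 : -toComplex (-π ^ 3) ^ s * (toComplex (-π ^ 3) ^ t) ^ l
      = toComplex (((-1) ^ (t * l + s + 1) * π ^ (t * l + s)) ^ 3) := by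
    have h2 : -(-π ^ 3) ^ (t * l + s) = ((-1) ^ (t * l + s + 1) * π ^ (t * l + s)) ^ 3 := by
      have h3 : ((-1 : Eis) ^ (t * l + s)) ^ 3 = (-1) ^ (t * l + s) := by
        rw [← pow_mul, mul_comm, pow_mul]; norm_num
      rw [neg_pow (π ^ 3), mul_pow, pow_succ (-1 : Eis), mul_pow, h3]
      ring
    rw [← h2, ← map_pow toComplex, ← map_pow toComplex, ← map_pow toComplex, ← map_neg toComplex,
      ← map_mul toComplex]
    congr 1
    ring
  rw [h1] at hl
  have h4 := two_mul_toComplex_re (((-1) ^ (t * l + s + 1) * π ^ (t * l + s)) ^ 3)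
  have h5 : (0 : ℝ) < (trace (((-1) ^ (t * l + s + 1) * π ^ (t * l + s)) ^ 3) : ℤ) := by
    rw [← h4]; positivity
  exact_mod_cast h5

theorem gpGraph_galoisField_of_trace_pos {p b : ℕ} [hp : Fact p.Prime] (hb : p = 3 * b + 1)
    {π : Eis} (hπ : IsPrimaryOfNorm p 1 π) {r : ℕ} (hr : r ≠ 0)
    (h : 0 < trace (((-1) ^ (r + 1) * π ^ r) ^ 3)) :
    Equienergetic (gpGraph (GaloisField p (3 * r)) 3) (gpGraph (GaloisField p (3 * r)) 3)ᶜ ∧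
      ¬ Isospectral (gpGraph (GaloisField p (3 * r)) 3) (gpGraph (GaloisField p (3 * r)) 3)ᶜ := by
  let := Fintype.ofFinite (GaloisField p (3 * r))
  have hr3 : 3 * r ≠ 0 := by omega
  have hF : Fintype.card (GaloisField p (3 * r)) = p ^ (3 * r) := by
    rw [← Nat.card_eq_fintype_card, GaloisField.card p _ hr3]
  obtain ⟨a, χ, x₀, ha0, ha, hχ, hx₀, hcube, hJ⟩ :=
    exists_cubicChar_isPrimaryOfNorm (GaloisField p (3 * r)) hp.out hb hF
  obtain ⟨ρ, hρ, hJρ⟩ := hπ.eq_pow hp.out (by omega) hJ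
  -- Equal parities make the sign a cube as well, so that J = τ³.
  have hsign : (-1 : Eis) ^ (3 * r + 1) = ((-1) ^ (r + 1)) ^ 3 := by
    rw [← pow_mul, show (r + 1) * 3 = 3 * r + 1 + 2 by ring, pow_add _ _ 2]; norm_num
  refine equienergetic_and_not_isospectral (N := p ^ r) (τ := (-1) ^ (r + 1) * ρ ^ r) ha0 ha ?_
    (by rw [hF]; ring) hχ hx₀ hcube ?_ ?_
  · exact hp.out.two_le.trans (Nat.le_self_pow hr p)
  · rw [hJρ, hsign]; ring
  · rcases hρ with rfl | rfl
    · exact h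
    -- Exchanging π and star π does not change the trace.
    · rw [← trace_star] at h
      simpa using h

end GPGraph

theorem theorem5p1 (p : ℕ) [Fact p.Prime] (hp : p ≡ 1 [MOD 3]) (t : ℕ) (ht : 0 < t)
    (hsol : ∃ x y : ℤ, IsCoprime x (p : ℤ) ∧ (p : ℤ) ^ t = x ^ 2 + 27 * y ^ 2)
    (s : ℕ) (hs : s < t) :
    {ℓ : ℕ | 0 < ℓ ∧
      GPGraph.Equienergetic (GPGraph.gpGraph (GaloisField p (3 * (t * ℓ + s))) 3)
        (GPGraph.gpGraph (GaloisField p (3 * (t * ℓ + s))) 3)ᶜ ∧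
      ¬ GPGraph.Isospectral (GPGraph.gpGraph (GaloisField p (3 * (t * ℓ + s))) 3)
        (GPGraph.gpGraph (GaloisField p (3 * (t * ℓ + s))) 3)ᶜ}.Infinite := by
  obtain ⟨b, hb⟩ : ∃ b, p = 3 * b + 1 := ⟨p / 3, by unfold Nat.ModEq at hp; omega⟩
  obtain ⟨π, hπ⟩ := GPGraph.exists_isPrimaryOfNorm hb one_ne_zero
  refine ((GPGraph.infinite_setOf_trace_pos hb hπ ht s).sdiff (Set.finite_singleton 0)).mono ?_
  rintro l ⟨hl, hl0⟩
  have hl1 : l ≠ 0 := hl0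
  have hr : t * l + s ≠ 0 := by
    have := Nat.mul_pos ht (Nat.pos_of_ne_zero hl1)
    omega
  exact ⟨Nat.pos_of_ne_zero hl1, GPGraph.gpGraph_galoisField_of_trace_pos hb hπ hr hl⟩
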